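/- Let $\varphi_0,\varphi_1,\dots$ be the standard numbering of the unary partial computable functions and $W_e=\operatorname{dom}\varphi_e$; let $D_k$ be the finite subset of $\mathbb N$ with Gödel number $k$, i.e. $k=\sum_{i\in D_k}2^i$. A computable group $(G,\nu)$ is a group $G$ with a surjection $\nu:\mathbb N\to G$ such that $\{(i,j,k):\nu(i)\nu(j)=\nu(k)\}$ is decidable. A Følner sequence of $G$ is a sequence $(F_j)_{j\in\mathbb N}$ of non-empty finite subsets of $G$ such that $\lim_{j\to\infty}|F_j\setminus gF_j|/|F_j|=0$ for every $g\in G$. Let $\mathfrak F_{seq}(G,\nu)$ be the set of indices of effective Følner sequences of $(G,\nu)$, i.e. the set of all $m\in\mathbb N$ such that $\varphi_m$ is total and $(\nu(D_{\varphi_m(j)}))_{j\in\mathbb N}$ is a Følner sequence of $G$. Theorem. For every computable group $(G,\nu)$, the set $\mathfrak F_{seq}(G,\nu)$ belongs to the class $\Pi^0_3$ of the arithmetical hierarchy. Moreover, if $G\cong\bigoplus_{n\in\omega}\mathbb Z$, then $\mathfrak F_{seq}(G,\nu)$ is $\Pi^0_3$-complete with respect to computable many-one reductions; in particular, the set $\{e:\forall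 n\ W_{\varphi_e(n)}\text{ is finite}\}$ (where $W_{\varphi_e(n)}=\emptyset$ if $\varphi_e(n)$ is undefined) is many-one reducible to $\mathfrak F_{seq}(G,\nu)$. -/

import Mathlib

/-- The partial computable function `φ_e` with index `e`, in the standard (acceptable) numbering
of the unary partial computable functions. -/
def phi (e : ℕ) : ℕ →. ℕ := (Denumerable.ofNat Nat.Partrec.Code e).eval

/-- The computably enumerable set `W_e = dom φ_e`. -/
def cee (e : ℕ) : Set ℕ := (phi e).Dom

/-- The finite subset of `ℕ` with Goedel number `n` (its canonical index): the set `D` with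
`n = ∑ i ∈ D, 2 ^ i`. -/
def finsetOfNumber (n : ℕ) : Finset ℕ := n.bitIndices.toFinset

theorem sum_two_pow_finsetOfNumber (n : ℕ) : ∑ i ∈ finsetOfNumber n, 2 ^ i = n := by
  simp [finsetOfNumber]

/-- The class `Σ⁰_n` of the arithmetical hierarchy: `Σ⁰_0` consists of the decidable sets, and a
set is `Σ⁰_{n+1}` if it has the form `{x | ∃ y, (x, y) ∉ B}` for some `B` in `Σ⁰_n`, that is, if it
is the projection of a `Π⁰_n` set (pairs are coded by the pairing function `Nat.pair`). -/
def IsSigma0 : ℕ → Set ℕ → Prop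
  | 0, A => ComputablePred fun x => x ∈ A
  | n + 1, A => ∃ B : Set ℕ, IsSigma0 n B ∧ ∀ x, x ∈ A ↔ ∃ y, Nat.pair x y ∉ B

/-- The class `Π⁰_n` of the arithmetical hierarchy: complements of `Σ⁰_n` sets. -/
def IsPi0 (n : ℕ) (A : Set ℕ) : Prop := IsSigma0 n Aᶜ

/-- `A` is `Π⁰_n`-complete (with respect to computable many-one reductions). -/
def IsPi0Complete (n : ℕ) (A : Set ℕ) : Prop :=
  IsPi0 n A ∧ ∀ B : Set ℕ, IsPi0 n B → (fun x => x ∈ B) ≤₀ (fun x => x ∈ A)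

/-- The numbered group `(G, ν)` is a computable group, `ν` being its constructivization:
`ν : ℕ → G` is onto and the set of all `(i, j, k)` with `ν i * ν j = ν k` is decidable. -/
def IsComputableGroup {G : Type*} [Group G] (ν : ℕ → G) : Prop :=
  Function.Surjective ν ∧ ComputablePred fun t : ℕ × ℕ × ℕ => ν t.1 * ν t.2.1 = ν t.2.2

open Classical in
/-- `(F_j)` is a Foelner sequence of `G`: all the `F_j` are non-empty finite sets, and
`|F_j \ g F_j| / |F_j| → 0` for every `g` in `G`. -/
def IsFoelnerSeq {G : Type*} [Group G] (F : ℕ → Finset G) : Prop :=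
  (∀ j, (F j).Nonempty) ∧
    ∀ g : G, Filter.Tendsto
      (fun j => ((F j \ (F j).image (fun x => g * x)).card : ℝ) / ((F j).card : ℝ))
      Filter.atTop (nhds 0)

open Classical in
/-- The set of (indices of) effective Foelner sequences of `(G, ν)`: all `m` such that `φ_m` is a
total function and the sets `F_j = ν(D_{φ_m(j)})`, with `D_k` the finite set of Goedel number `k`,
form a Foelner sequence of `G`. -/
def foelnerIndices {G : Type*} [Group G] (ν : ℕ → G) : Set ℕ :=
  {m | ∃ f : ℕ → ℕ, (∀ j, f j ∈ phi m j) ∧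
    IsFoelnerSeq fun j => (finsetOfNumber (f j)).image ν}

/-- The set of all `e` such that `W_{φ_e(n)}` is finite for every `n`, where `W_{φ_e(n)}` is
empty if `φ_e(n)` is undefined. -/
def allFiniteIndices : Set ℕ :=
  {e | ∀ n, {x | ∃ v ∈ phi e n, x ∈ cee v}.Finite}

/-! Upper bound: since multiplication is decidable, `|F|` and `|F \ gF|` are computable from
indices. Totality with non-empty values, and "for all `g`, `k` there is `N` with `k|F_j \ gF_j| ≤
|F_j|` for all `j ≥ N`", then merge into one `∀∃∀` formula.

Hardness: for a `∀∃∀` predicate there is a computable `h` that tends to infinity exactly when the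
predicate holds (`forall_exists_forall_iff_tendsto_stableCount`). Let `F_s` consist of the products
of `ν 0, …, ν (h s - 1)` with exponents in `[0, s]`. If `h` tends to infinity, each `ν i` eventually
translates `F_s` along one of its own directions, so `F_s` is Følner. If `h s < y` infinitely often,
those `F_s` lie in the subgroup generated by `ν 0, …, ν (y - 1)`. This subgroup is proper, and any
`g` outside it moves `F_s` off itself (`isFoelnerSeq_box_iff`). Hence hardness needs only a
commutative group that is not finitely generated; no independence of the `ν i` is used. -/

section Computability

/-! ### Closure properties of computable functions and predicates -/

variable {α : Type*} [Primcodable α]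

theorem Computable.ite {c : α → Prop} [DecidablePred c] {σ : Type*} [Primcodable σ] {f g : α → σ}
    (hc : ComputablePred c) (hf : Computable f) (hg : Computable g) :
    Computable fun a => if c a then f a else g a :=
  (Computable.cond hc.decide hf hg).of_eq fun a => by by_cases h : c a <;> simp [h]

theorem ComputablePred.nat_eq {f g : α → ℕ} (hf : Computable f) (hg : Computable g) :
    ComputablePred fun a => f a = g a :=
  Computable.computablePred <|
    (Primrec.eq (α := ℕ)).decide.to_comp.comp hf hg

theorem ComputablePred.nat_le {f g : α → ℕ} (hf : Computable f) (hg : Computable g) :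
    ComputablePred fun a => f a ≤ g a :=
  Computable.computablePred <|
    Primrec.nat_le.decide.to_comp.comp hf hg

theorem ComputablePred.nat_lt {f g : α → ℕ} (hf : Computable f) (hg : Computable g) :
    ComputablePred fun a => f a < g a :=
  nat_le (Computable.succ.comp hf) hg

theorem ComputablePred.comp {β : Type*} [Primcodable β] {p : β → Prop} (hp : ComputablePred p)
    {f : α → β} (hf : Computable f) : ComputablePred fun a => p (f a) := by
  obtain ⟨_, hp⟩ := hp
  exact ⟨fun a => inferInstance, hp.comp hf⟩

/-- Counting is the basic bounded search: bounded quantifiers, cardinalities of coded sets and the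
stage functions of the reduction are all instances of it. -/
theorem Computable.nat_count {p : α → ℕ → Prop} [∀ a, DecidablePred (p a)] {n : α → ℕ}
    (hp : ComputablePred fun x : α × ℕ => p x.1 x.2) (hn : Computable n) :
    Computable fun a => Nat.count (p a) (n a) := by
  have step : Computable₂ fun (a : α) (x : ℕ × ℕ) => x.2 + if p a x.1 then 1 else 0 :=
    Primrec.nat_add.to_comp.comp (Computable.snd.comp Computable.snd)
      (Computable.ite (hp.comp (Computable.fst.pair (Computable.fst.comp Computable.snd)))
        (Computable.const 1) (Computable.const 0))
  refine (Computable.nat_rec hn (Computable.const 0) step).of_eq fun a => ?_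
  induction n a with
  | zero => simp
  | succ k ih => simp only [Nat.count_succ, ← ih]

theorem ComputablePred.forall_lt {p : α → ℕ → Prop} {n : α → ℕ}
    (hp : ComputablePred fun x : α × ℕ => p x.1 x.2) (hn : Computable n) :
    ComputablePred fun a => ∀ i < n a, p a i := by
  classical
  refine (ComputablePred.nat_eq (Computable.nat_count hp hn) hn).of_eq fun a => ?_
  exact Nat.count_iff_forall

theorem ComputablePred.and {p q : α → Prop} (hp : ComputablePred p) (hq : ComputablePred q) :
    ComputablePred fun a => p a ∧ q a := by
  classical
  exact Computable.computablePred <|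
    (Primrec.and.to_comp.comp hp.decide hq.decide).of_eq fun a => by simp

theorem ComputablePred.imp {p q : α → Prop} (hp : ComputablePred p) (hq : ComputablePred q) :
    ComputablePred fun a => p a → q a :=
  (hp.and hq.not).not.of_eq fun a => by tauto

theorem ComputablePred.exists_lt {p : α → ℕ → Prop} {n : α → ℕ}
    (hp : ComputablePred fun x : α × ℕ => p x.1 x.2) (hn : Computable n) :
    ComputablePred fun a => ∃ i < n a, p a i :=
  (forall_lt (p := fun a i => ¬ p a i) hp.not hn).not.of_eq fun a => by push Not; rfl

theorem Computable.nat_pow {f g : α → ℕ} (hf : Computable f) (hg : Computable g) :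
    Computable fun a => f a ^ g a :=
  (Primrec₂.unpaired'.1 Nat.Primrec.pow).to_comp.comp hf hg

theorem ComputablePred.mem_finsetOfNumber {f g : α → ℕ} (hf : Computable f) (hg : Computable g) :
    ComputablePred fun a => f a ∈ finsetOfNumber (g a) := by
  refine (ComputablePred.nat_eq (Primrec.nat_mod.to_comp.comp (Primrec.nat_div.to_comp.comp hg
    (Computable.nat_pow (Computable.const 2) hf)) (Computable.const 2))
    (Computable.const 1)).of_eq fun a => ?_
  simp [finsetOfNumber, Nat.testBit_eq_decide_div_mod_eq]

theorem lt_of_mem_finsetOfNumber {i n : ℕ} (h : i ∈ finsetOfNumber n) : i < n :=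
  i.lt_two_pow_self.trans_le (Nat.two_pow_le_of_mem_bitIndices (by simpa [finsetOfNumber] using h))

end Computability

/-! ### Normal form for `Π⁰₃` sets -/

section Pi3

theorem isPi0_three_iff {A : Set ℕ} : IsPi0 3 A ↔ ∃ R : ℕ → ℕ → ℕ → ℕ → Prop,
    ComputablePred (fun t : ℕ × ℕ × ℕ × ℕ => R t.1 t.2.1 t.2.2.1 t.2.2.2) ∧
      ∀ x, x ∈ A ↔ ∀ y, ∃ z, ∀ w, R x y z w := by
  constructor
  · rintro ⟨B₂, ⟨B₁, ⟨B₀, h₀, h₁⟩, h₂⟩, h₃⟩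
    refine ⟨fun x y z w => Nat.pair (Nat.pair (Nat.pair x y) z) w ∈ B₀, ?_, fun x => ?_⟩
    · have hp := Primrec₂.natPair.to_comp
      exact h₀.comp (hp.comp (hp.comp (hp.comp .fst (.comp .fst .snd))
        (.comp .fst (.comp .snd .snd))) (.comp .snd (.comp .snd .snd)))
    · have := h₃ x
      simp only [h₂, h₁, Set.mem_compl_iff] at this
      rw [← not_iff_not, this]
      push Not
      rfl
  · rintro ⟨R, hR, h⟩
    let R' : ℕ → ℕ → ℕ → Prop := fun n z w => R n.unpair.1 n.unpair.2 z w
    refine ⟨{n | ∃ z, ∀ w, R' n z w}, ⟨{n | ∃ w, ¬ R' n.unpair.1 n.unpair.2 w},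
      ⟨{n | R' n.unpair.1.unpair.1 n.unpair.1.unpair.2 n.unpair.2}, ?_, ?_⟩, ?_⟩, ?_⟩
    · have l {f : ℕ → ℕ} (hf : Computable f) : Computable fun n => (f n).unpair.1 :=
        Computable.fst.comp (Computable.unpair.comp hf)
      have r {f : ℕ → ℕ} (hf : Computable f) : Computable fun n => (f n).unpair.2 :=
        Computable.snd.comp (Computable.unpair.comp hf)
      exact hR.comp ((l (l (l .id))).pair ((r (l (l .id))).pair ((r (l .id)).pair (r .id))))
    · intro n; simp [R']
    · intro n; simp [R']
    · intro x; simp [R', h]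

/-- Lets each quantifier range over tuples, so that several like quantifiers can be contracted into
one. -/
theorem isPi0_three_of_denumerable {A : Set ℕ} {α β γ : Type*} [Denumerable α] [Denumerable β]
    [Denumerable γ] {R : ℕ → α → β → γ → Prop}
    (hR : ComputablePred fun t : ℕ × α × β × γ => R t.1 t.2.1 t.2.2.1 t.2.2.2)
    (h : ∀ x, x ∈ A ↔ ∀ a, ∃ b, ∀ c, R x a b c) : IsPi0 3 A := by
  refine isPi0_three_iff.2 ⟨fun x y z w => R x (Denumerable.ofNat α y) (Denumerable.ofNat β z)
    (Denumerable.ofNat γ w), ?_, fun x => ?_⟩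
  · exact hR.comp (Computable.fst.pair (((Computable.ofNat α).comp (.comp .fst .snd)).pair
      (((Computable.ofNat β).comp (.comp .fst (.comp .snd .snd))).pair
        ((Computable.ofNat γ).comp (.comp .snd (.comp .snd .snd))))))
  · rw [h, ← (Denumerable.eqv α).symm.forall_congr_right]
    refine forall_congr' fun y => ?_
    rw [← (Denumerable.eqv β).symm.exists_congr_right]
    refine exists_congr fun z => ?_
    rw [← (Denumerable.eqv γ).symm.forall_congr_right]
    rfl

/-- The program with index `e`, run on `x`, stops with the value `v` within `s` steps. -/
def HaltsInWith (s e x v : ℕ) : Prop :=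
  v ∈ Nat.Partrec.Code.evaln s (Denumerable.ofNat Nat.Partrec.Code e) x

theorem mem_phi_iff {e x v : ℕ} : v ∈ phi e x ↔ ∃ s, HaltsInWith s e x v :=
  Nat.Partrec.Code.evaln_complete

theorem HaltsInWith.mono {s s' e x v : ℕ} (h : HaltsInWith s e x v) (hs : s ≤ s') :
    HaltsInWith s' e x v :=
  Nat.Partrec.Code.evaln_mono hs h

theorem ComputablePred.haltsInWith {α : Type*} [Primcodable α] {s e x v : α → ℕ}
    (hs : Computable s) (he : Computable e) (hx : Computable x) (hv : Computable v) :
    ComputablePred fun a => HaltsInWith (s a) (e a) (x a) (v a) := by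
  have run := Nat.Partrec.Code.primrec_evaln.to_comp.comp
    ((hs.pair ((Computable.ofNat Nat.Partrec.Code).comp he)).pair hx)
  exact Computable.computablePred (p := fun a => _ = some (v a)) <|
    (Primrec.eq (α := Option ℕ)).decide.to_comp.comp run (Computable.option_some.comp hv)

theorem isPi0_three_allFiniteIndices : IsPi0 3 allFiniteIndices := by
  refine isPi0_three_of_denumerable (α := ℕ) (β := ℕ) (γ := ℕ × ℕ × ℕ × ℕ)
    (R := fun e n N ⟨s, v, x, u⟩ => HaltsInWith s e n v → HaltsInWith s v x u → x < N) ?_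
    fun e => ?_
  · have hs : Computable fun t : ℕ × ℕ × ℕ × ℕ × ℕ × ℕ × ℕ => t.2.2.2.1 :=
      .comp .fst (.comp .snd (.comp .snd .snd))
    have hv : Computable fun t : ℕ × ℕ × ℕ × ℕ × ℕ × ℕ × ℕ => t.2.2.2.2.1 :=
      .comp .fst (.comp .snd (.comp .snd (.comp .snd .snd)))
    have hx : Computable fun t : ℕ × ℕ × ℕ × ℕ × ℕ × ℕ × ℕ => t.2.2.2.2.2.1 :=
      .comp .fst (.comp .snd (.comp .snd (.comp .snd (.comp .snd .snd))))
    have hu : Computable fun t : ℕ × ℕ × ℕ × ℕ × ℕ × ℕ × ℕ => t.2.2.2.2.2.2 :=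
      .comp .snd (.comp .snd (.comp .snd (.comp .snd (.comp .snd .snd))))
    exact (ComputablePred.haltsInWith hs .fst (.comp .fst .snd) hv).imp
      ((ComputablePred.haltsInWith hs hv hx hu).imp
        (.nat_lt hx (.comp .fst (.comp .snd .snd))))
  · refine forall_congr' fun n => ?_
    constructor
    · intro h
      obtain ⟨N, hN⟩ := h.bddAbove
      exact ⟨N + 1, fun ⟨s, v, x, u⟩ h₁ h₂ => Nat.lt_succ_of_le <| hN
        ⟨v, mem_phi_iff.2 ⟨s, h₁⟩, (PFun.mem_dom _ _).2 ⟨u, mem_phi_iff.2 ⟨s, h₂⟩⟩⟩⟩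
    · rintro ⟨N, hN⟩
      refine (Set.finite_lt_nat N).subset ?_
      rintro x ⟨v, hv, hx⟩
      obtain ⟨u, hu⟩ := (PFun.mem_dom _ _).1 hx
      obtain ⟨s₁, h₁⟩ := mem_phi_iff.1 hv
      obtain ⟨s₂, h₂⟩ := mem_phi_iff.1 hu
      -- The formula uses one step bound for both computations; by monotonicity the larger one
      -- serves.
      exact hN ⟨max s₁ s₂, v, x, u⟩ (h₁.mono (le_max_left _ _)) (h₂.mono (le_max_right _ _))

end Pi3

/-! ### Følner conditions on coded finite sets, and the upper bound -/

section Foelner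

open Classical in
/-- Division-free form of the Foelner condition. -/
theorem isFoelnerSeq_iff {G : Type*} [Group G] {F : ℕ → Finset G} :
    IsFoelnerSeq F ↔ (∀ j, (F j).Nonempty) ∧ ∀ g : G, ∀ k : ℕ, ∃ N, ∀ j ≥ N,
      k * (F j \ (F j).image (fun x => g * x)).card ≤ (F j).card := by
  refine and_congr_right fun hne => forall_congr' fun g => ?_
  have hpos (j : ℕ) : (0 : ℝ) < (F j).card := by exact_mod_cast (hne j).card_pos
  rw [Metric.tendsto_atTop]
  constructor
  · intro h k
    -- `k + 1` rather than `k` keeps the tolerance positive when `k = 0`.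
    obtain ⟨N, hN⟩ := h (1 / (k + 1)) (by positivity)
    refine ⟨N, fun j hj => ?_⟩
    have := hN j hj
    rw [Real.dist_0_eq_abs, abs_of_nonneg (by positivity), div_lt_div_iff₀ (hpos j) (by positivity)]
      at this
    have h' : ((k * (F j \ (F j).image (fun x => g * x)).card : ℕ) : ℝ) ≤ (F j).card := by
      push_cast
      nlinarith [Nat.cast_nonneg (α := ℝ) (F j \ (F j).image (fun x => g * x)).card]
    exact_mod_cast h'
  · intro h ε hε
    obtain ⟨k, hk⟩ := exists_nat_gt (1 / ε)
    have hk0 : (0 : ℝ) < k := (by positivity : 0 < 1 / ε).trans hk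
    obtain ⟨N, hN⟩ := h k
    refine ⟨N, fun j hj => ?_⟩
    have h' : (k : ℝ) * (F j \ (F j).image (fun x => g * x)).card ≤ (F j).card := by
      exact_mod_cast hN j hj
    rw [Real.dist_0_eq_abs, abs_of_nonneg (by positivity), div_lt_iff₀ (hpos j)]
    rw [div_lt_iff₀ hε] at hk
    have := mul_le_mul_of_nonneg_left h' hε.le
    nlinarith [hpos j]

open Classical in
-- Each `x` in `F \ gF` starts a chain `x, gx, …, g ^ (n - 1) x` inside `F`, and all these points
-- are distinct: if `g ^ k * x = g ^ l * y` with `k < l`, then `x` is `g` times an earlier point of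
-- the chain of `y`, so `x` lies in `gF`. No assumption on the order of `g` is needed.
theorem card_sdiff_image_mul_le {G : Type*} [Group G] {F : Finset G} {g : G} {n : ℕ}
    (h : ∀ x ∈ F, x ∉ F.image (fun x => g * x) → ∀ k < n, g ^ k * x ∈ F) :
    n * (F \ F.image (fun x => g * x)).card ≤ F.card := by
  have key {x y : G} {k l : ℕ} (hx : x ∉ F.image (fun x => g * x))
      (hy : ∀ k < n, g ^ k * y ∈ F) (hl : l < n) (hxy : g ^ k * x = g ^ l * y) : l ≤ k := by
    by_contra! hkl
    obtain ⟨d, rfl⟩ := Nat.exists_eq_add_of_lt hkl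
    refine hx (Finset.mem_image.2 ⟨g ^ d * y, hy d (by omega), ?_⟩)
    rw [add_assoc, pow_add, mul_assoc, mul_left_cancel_iff, pow_succ', mul_assoc] at hxy
    exact hxy.symm
  have : ((Finset.range n) ×ˢ (F \ F.image (fun x => g * x))).card ≤ F.card := by
    refine Finset.card_le_card_of_injOn (fun p => g ^ p.1 * p.2) ?_ ?_
    · rintro ⟨k, x⟩ hp
      simp only [Finset.coe_product, Set.mem_prod, Finset.mem_coe, Finset.mem_range,
        Finset.mem_sdiff] at hp
      exact h x hp.2.1 hp.2.2 k hp.1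
    · rintro ⟨k, x⟩ hp ⟨l, y⟩ hq hpq
      simp only [Finset.coe_product, Set.mem_prod, Finset.mem_coe, Finset.mem_range,
        Finset.mem_sdiff] at hp hq hpq
      obtain rfl : k = l := le_antisymm (key hq.2.2 (h x hp.2.1 hp.2.2) hp.1 hpq.symm)
        (key hp.2.2 (h y hq.2.1 hq.2.2) hq.1 hpq)
      rw [mul_left_cancel hpq]
  simpa using this

theorem finsetOfNumber_sum (S : Finset ℕ) : finsetOfNumber (∑ i ∈ S, 2 ^ i) = S :=
  Finset.toFinset_bitIndices_sum_two_pow S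

open Classical in
/-- The Goedel number of `finsetOfNumber v ∪ {a}`. -/
noncomputable def insertNumber (a v : ℕ) : ℕ :=
  if a ∈ finsetOfNumber v then v else v + 2 ^ a

theorem finsetOfNumber_insertNumber (a v : ℕ) :
    finsetOfNumber (insertNumber a v) = insert a (finsetOfNumber v) := by
  unfold insertNumber
  split_ifs with h
  · rw [Finset.insert_eq_of_mem h]
  · conv_rhs => rw [← finsetOfNumber_sum (insert a (finsetOfNumber v))]
    rw [Finset.sum_insert h, sum_two_pow_finsetOfNumber, add_comm]

/-- The Goedel number of the set of the first `n` values of `f`. -/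
noncomputable def imageNumber (f : ℕ → ℕ) : ℕ → ℕ
  | 0 => 0
  | n + 1 => insertNumber (f n) (imageNumber f n)

theorem finsetOfNumber_imageNumber (f : ℕ → ℕ) (n : ℕ) :
    finsetOfNumber (imageNumber f n) = (Finset.range n).image f := by
  induction n with
  | zero => simp [imageNumber, finsetOfNumber]
  | succ n ih =>
    rw [imageNumber, finsetOfNumber_insertNumber, ih, Finset.range_add_one, Finset.image_insert]

theorem Computable.imageNumber {α : Type*} [Primcodable α] {f : α → ℕ → ℕ} {n : α → ℕ}
    (hf : Computable₂ f) (hn : Computable n) : Computable fun a => imageNumber (f a) (n a) := by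
  have step : Computable₂ fun (a : α) (x : ℕ × ℕ) => insertNumber (f a x.1) x.2 := by
    have h₁ : Computable fun p : α × ℕ × ℕ => f p.1 p.2.1 :=
      hf.comp .fst (.comp .fst .snd)
    have h₂ : Computable fun p : α × ℕ × ℕ => p.2.2 := .comp .snd .snd
    exact .ite (.mem_finsetOfNumber h₁ h₂) h₂
      (Primrec.nat_add.to_comp.comp h₂ (.nat_pow (.const 2) h₁))
  refine (Computable.nat_rec hn (.const 0) step).of_eq fun a => ?_
  induction n a with
  | zero => rfl
  | succ k ih => simp only [_root_.imageNumber, ← ih]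

/-- `a` is the least element of `finsetOfNumber v` with the value `ν a`. -/
def IsLeastRep {G : Type*} (ν : ℕ → G) (v a : ℕ) : Prop :=
  a ∈ finsetOfNumber v ∧ ∀ b < a, b ∈ finsetOfNumber v → ν b ≠ ν a

open Classical in
-- As `ν` need not be injective, elements of the image are counted through their least
-- representatives.
theorem card_filter_image_finsetOfNumber {G : Type*} (ν : ℕ → G) (v : ℕ) (Q : G → Prop) :
    (((finsetOfNumber v).image ν).filter Q).card =
      Nat.count (fun a => IsLeastRep ν v a ∧ Q (ν a)) v := by
  rw [Nat.count_eq_card_filter_range, ← Finset.card_image_of_injOn (f := ν)]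
  · congr 1
    ext x
    simp only [Finset.mem_filter, Finset.mem_image, Finset.mem_range]
    constructor
    · rintro ⟨hx, hQ⟩
      refine ⟨Nat.find hx, ⟨lt_of_mem_finsetOfNumber (Nat.find_spec hx).1,
        ⟨(Nat.find_spec hx).1, fun b hb hbv hb' => ?_⟩, ?_⟩, (Nat.find_spec hx).2⟩
      · exact Nat.find_min hx hb ⟨hbv, hb'.trans (Nat.find_spec hx).2⟩
      · rwa [(Nat.find_spec hx).2]
    · rintro ⟨a, ⟨-, ha, hQ⟩, rfl⟩
      exact ⟨⟨a, ha.1, rfl⟩, hQ⟩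
  · intro a ha b hb hab
    simp only [Finset.coe_filter, Set.mem_ofPred_eq] at ha hb
    rcases lt_trichotomy a b with h | h | h
    · exact absurd hab (hb.2.1.2 a h ha.2.1.1)
    · exact h
    · exact absurd hab.symm (ha.2.1.2 b h hb.2.1.1)

variable {G : Type*} [Group G] {ν : ℕ → G}

theorem IsComputableGroup.mul_eq (hν : IsComputableGroup ν) {α : Type*} [Primcodable α]
    {f g h : α → ℕ} (hf : Computable f) (hg : Computable g) (hh : Computable h) :
    ComputablePred fun a => ν (f a) * ν (g a) = ν (h a) :=
  hν.2.comp (hf.pair (hg.pair hh))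

theorem IsComputableGroup.eq (hν : IsComputableGroup ν) {α : Type*} [Primcodable α]
    {f g : α → ℕ} (hf : Computable f) (hg : Computable g) :
    ComputablePred fun a => ν (f a) = ν (g a) := by
  obtain ⟨e, he⟩ := hν.1 1
  exact (hν.mul_eq (.const e) hf hg).of_eq fun a => by rw [he, one_mul]

theorem IsComputableGroup.exists_mul (hν : IsComputableGroup ν) :
    ∃ m : ℕ → ℕ → ℕ, Computable₂ m ∧ ∀ a b, ν (m a b) = ν a * ν b := by
  classical
  have hex (p : ℕ × ℕ) : ∃ c, ν p.1 * ν p.2 = ν c := (hν.1 _).imp fun _ h => h.symm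
  refine ⟨fun a b => Nat.find (hex (a, b)), ?_, fun a b => (Nat.find_spec (hex (a, b))).symm⟩
  exact Computable.find (P := fun (p : ℕ × ℕ) c => ν p.1 * ν p.2 = ν c)
    (hν.mul_eq (.comp .fst .fst) (.comp .snd .fst) .snd) hex

theorem IsComputableGroup.exists_pow (hν : IsComputableGroup ν) :
    ∃ p : ℕ → ℕ → ℕ, Computable₂ p ∧ ∀ a n, ν (p a n) = ν a ^ n := by
  obtain ⟨m, hm, hm'⟩ := hν.exists_mul
  obtain ⟨e, he⟩ := hν.1 1
  refine ⟨fun a n => Nat.rec (motive := fun _ => ℕ) e (fun _ c => m c a) n,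
    Computable.nat_rec (α := ℕ × ℕ) (f := Prod.snd) (g := fun _ => e) (h := fun x c => m c.2 x.1)
      .snd (.const e) (hm.comp (.comp .snd .snd) (.comp .fst .fst)), fun a n => ?_⟩
  induction n with
  | zero => simpa using he
  | succ n ih => simp only [hm', ih, pow_succ]

theorem IsComputableGroup.isLeastRep (hν : IsComputableGroup ν) {α : Type*} [Primcodable α]
    {f g : α → ℕ} (hf : Computable f) (hg : Computable g) :
    ComputablePred fun a => IsLeastRep ν (f a) (g a) :=
  (ComputablePred.mem_finsetOfNumber hg hf).and
    (.forall_lt (p := fun a b => b ∈ finsetOfNumber (f a) → ν b ≠ ν (g a))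
      (.imp (.mem_finsetOfNumber .snd (hf.comp .fst)) (hν.eq .snd (hg.comp .fst)).not) hg)

open Classical in
theorem IsComputableGroup.card_image_finsetOfNumber (hν : IsComputableGroup ν) {α : Type*}
    [Primcodable α] {f : α → ℕ} (hf : Computable f) :
    Computable fun a => ((finsetOfNumber (f a)).image ν).card := by
  refine (Computable.nat_count (p := fun a b => IsLeastRep ν (f a) b)
    (hν.isLeastRep (hf.comp .fst) .snd) hf).of_eq fun a => ?_
  simpa using (card_filter_image_finsetOfNumber ν (f a) fun _ => True).symm

open Classical in
theorem IsComputableGroup.card_sdiff_image (hν : IsComputableGroup ν) {α : Type*}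
    [Primcodable α] {f g : α → ℕ} (hf : Computable f) (hg : Computable g) :
    Computable fun a => ((finsetOfNumber (f a)).image ν \
      ((finsetOfNumber (f a)).image ν).image (fun x => ν (g a) * x)).card := by
  refine (Computable.nat_count (p := fun a b => IsLeastRep ν (f a) b ∧
    ∀ c < f a, c ∈ finsetOfNumber (f a) → ν (g a) * ν c ≠ ν b) (.and
    (hν.isLeastRep (hf.comp .fst) .snd) (.forall_lt (p := fun (x : α × ℕ) c =>
      c ∈ finsetOfNumber (f x.1) → ν (g x.1) * ν c ≠ ν x.2) (.imp
        (.mem_finsetOfNumber .snd (hf.comp (.comp .fst .fst)))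
        (hν.mul_eq (hg.comp (.comp .fst .fst)) .snd (.comp .snd .fst)).not)
      (hf.comp .fst))) hf).of_eq fun a => ?_
  have := card_filter_image_finsetOfNumber ν (f a) fun y =>
    ∀ c < f a, c ∈ finsetOfNumber (f a) → ν (g a) * ν c ≠ y
  refine Eq.trans (by convert this.symm) (congrArg Finset.card ?_)
  ext x
  simp only [Finset.mem_filter, Finset.mem_sdiff, Finset.mem_image]
  refine and_congr_right fun _ => ?_
  constructor
  · rintro h ⟨_, ⟨c, hc, rfl⟩, hx⟩
    exact h c (lt_of_mem_finsetOfNumber hc) hc hx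
  · intro h c _ hc hx
    exact h ⟨_, ⟨c, hc, rfl⟩, hx⟩

theorem finsetOfNumber_nonempty {v : ℕ} : (finsetOfNumber v).Nonempty ↔ v ≠ 0 := by
  rw [Finset.nonempty_iff_ne_empty, not_iff_not]
  constructor
  · intro h
    rw [← sum_two_pow_finsetOfNumber v, h, Finset.sum_empty]
  · rintro rfl
    simp [finsetOfNumber]

theorem IsComputableGroup.isPi0_three_foelnerIndices (hν : IsComputableGroup ν) :
    IsPi0 3 (foelnerIndices ν) := by
  classical
  refine isPi0_three_of_denumerable (α := ℕ × ℕ × ℕ) (β := ℕ × ℕ × ℕ) (γ := ℕ × ℕ × ℕ)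
    -- Here `p = (j, k, i)` holds an input, a factor and a code of `g`; `q = (N, s, v)` holds a
    -- threshold and a halting witness for `j`; `r` is a later computation to be tested. The value
    -- `0` codes the empty set.
    (R := fun m p q r => (HaltsInWith q.2.1 m p.1 q.2.2 ∧ q.2.2 ≠ 0) ∧
      (HaltsInWith r.2.1 m r.1 r.2.2 → q.1 ≤ r.1 →
        p.2.1 * ((finsetOfNumber r.2.2).image ν \
          ((finsetOfNumber r.2.2).image ν).image (fun x => ν p.2.2 * x)).card ≤
            ((finsetOfNumber r.2.2).image ν).card)) ?_ fun m => ?_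
  · have hp : Computable fun t : ℕ × (ℕ × ℕ × ℕ) × (ℕ × ℕ × ℕ) × (ℕ × ℕ × ℕ) => t.2.1 :=
      .comp .fst .snd
    have hq : Computable fun t : ℕ × (ℕ × ℕ × ℕ) × (ℕ × ℕ × ℕ) × (ℕ × ℕ × ℕ) => t.2.2.1 :=
      .comp .fst (.comp .snd .snd)
    have hr : Computable fun t : ℕ × (ℕ × ℕ × ℕ) × (ℕ × ℕ × ℕ) × (ℕ × ℕ × ℕ) => t.2.2.2 :=
      .comp .snd (.comp .snd .snd)
    have c₁ : Computable fun x : ℕ × ℕ × ℕ => x.2.1 := .comp .fst .snd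
    have c₂ : Computable fun x : ℕ × ℕ × ℕ => x.2.2 := .comp .snd .snd
    exact .and (.and (.haltsInWith (c₁.comp hq) .fst (.comp .fst hp) (c₂.comp hq))
        (ComputablePred.nat_eq (c₂.comp hq) (.const 0)).not)
      (.imp (.haltsInWith (c₁.comp hr) .fst (.comp .fst hr) (c₂.comp hr))
        (.imp (.nat_le (.comp .fst hq) (.comp .fst hr))
          (.nat_le (Primrec.nat_mul.to_comp.comp (c₁.comp hp)
            (hν.card_sdiff_image (c₂.comp hr) (c₂.comp hp)))
            (hν.card_image_finsetOfNumber (c₂.comp hr)))))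
  · constructor
    · rintro ⟨f, hf, hF⟩ ⟨j, k, i⟩
      obtain ⟨hne, hF⟩ := isFoelnerSeq_iff.1 hF
      obtain ⟨s, hs⟩ := mem_phi_iff.1 (hf j)
      obtain ⟨N, hN⟩ := hF (ν i) k
      refine ⟨⟨N, s, f j⟩, fun ⟨l, s', v⟩ => ⟨⟨hs, ?_⟩, fun hv hl => ?_⟩⟩
      · exact finsetOfNumber_nonempty.1 (Finset.image_nonempty.1 (hne j))
      · obtain rfl : v = f l := Part.mem_unique (mem_phi_iff.2 ⟨s', hv⟩) (hf l)
        exact hN l hl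
    · intro h
      have htot (j : ℕ) : ∃ v ∈ phi m j, v ≠ 0 := by
        obtain ⟨q, hq⟩ := h (j, 0, 0)
        exact ⟨q.2.2, mem_phi_iff.2 ⟨_, (hq 0).1.1⟩, (hq 0).1.2⟩
      choose f hf hf0 using htot
      refine ⟨f, hf, isFoelnerSeq_iff.2
        ⟨fun j => (finsetOfNumber_nonempty.2 (hf0 j)).image _, fun g k => ?_⟩⟩
      obtain ⟨i, rfl⟩ := hν.1 g
      obtain ⟨q, hq⟩ := h (0, k, i)
      refine ⟨q.1, fun j hj => ?_⟩
      obtain ⟨s, hs⟩ := mem_phi_iff.1 (hf j)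
      exact (hq (j, s, f j)).2 hs hj

end Foelner

/-! ### Turning a `∀∃∀` predicate into divergence to infinity of a computable function -/

section Retardation

open Filter

/-- The count is the length of the longest initial segment on which `q` holds, truncated at `s`. -/
theorem le_count_forall_iff (q : ℕ → Prop) [DecidablePred fun y => ∀ y' < y + 1, q y'] {n s : ℕ} :
    n ≤ Nat.count (fun y => ∀ y' < y + 1, q y') s ↔ n ≤ s ∧ ∀ y < n, q y := by
  constructor
  · intro h
    refine ⟨h.trans (Nat.count_le _), fun y hy => ?_⟩
    by_contra hq
    refine (hy.trans_le h).not_ge ?_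
    rw [Nat.count_eq_card_filter_range]
    refine (Finset.card_le_card fun z hz => ?_).trans_eq (Finset.card_range y)
    by_contra hz'
    simp only [Finset.mem_filter, Finset.mem_range] at hz hz'
    exact hq (hz.2 y (by omega))
  · rintro ⟨hn, h⟩
    calc n = Nat.count (fun y => ∀ y' < y + 1, q y') n :=
          (Nat.count_iff_forall.2 fun y hy y' hy' => h y' (by omega)).symm
      _ ≤ _ := Nat.count_monotone _ hn

open Classical in
/-- The number of initial `z < s` that are refuted by some `w < s`. -/
noncomputable def refutedCount (R : ℕ → ℕ → Prop) (s : ℕ) : ℕ :=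
  Nat.count (fun z => ∀ z' < z + 1, ∃ w < s, ¬ R z' w) s

theorem le_refutedCount_iff {R : ℕ → ℕ → Prop} {n s : ℕ} :
    n ≤ refutedCount R s ↔ n ≤ s ∧ ∀ z < n, ∃ w < s, ¬ R z w := by
  classical
  exact le_count_forall_iff _

theorem refutedCount_monotone (R : ℕ → ℕ → Prop) : Monotone (refutedCount R) := by
  intro s t hst
  have := le_refutedCount_iff.1 (le_refl (refutedCount R s))
  refine le_refutedCount_iff.2 ⟨this.1.trans hst, fun z hz => ?_⟩
  obtain ⟨w, hw, h⟩ := this.2 z hz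
  exact ⟨w, hw.trans_le hst, h⟩

/-- The existential statement holds iff `refutedCount` is eventually constant. -/
theorem exists_forall_iff_eventually_refutedCount {R : ℕ → ℕ → Prop} :
    (∃ z, ∀ w, R z w) ↔ ∀ᶠ s in atTop, refutedCount R (s + 1) = refutedCount R s := by
  constructor
  · rintro ⟨z, hz⟩
    have hb (s : ℕ) : refutedCount R s ≤ z := by
      by_contra! h
      obtain ⟨w, -, hw⟩ := (le_refutedCount_iff.1 (le_refl (refutedCount R s))).2 z h
      exact hw (hz w)
    have hbdd : BddAbove (Set.range (refutedCount R)) := ⟨z, by rintro _ ⟨s, rfl⟩; exact hb s⟩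
    obtain ⟨s₀, hs₀⟩ := Nat.sSup_mem (Set.range_nonempty (refutedCount R)) hbdd
    filter_upwards [eventually_ge_atTop s₀] with s hs
    refine le_antisymm ?_ (refutedCount_monotone R s.le_succ)
    calc refutedCount R (s + 1) ≤ refutedCount R s₀ := hs₀ ▸ le_csSup hbdd ⟨_, rfl⟩
      _ ≤ refutedCount R s := refutedCount_monotone R hs
  · intro h
    by_contra! hR
    obtain ⟨s₀, hs₀⟩ := eventually_atTop.1 h
    have hconst (s : ℕ) (hs : s₀ ≤ s) : refutedCount R s = refutedCount R s₀ := by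
      induction s, hs using Nat.le_induction with
      | base => rfl
      | succ s hs ih => rw [hs₀ s hs, ih]
    have hz (z : ℕ) : ∀ᶠ s in atTop, ∃ w < s, ¬ R z w := by
      obtain ⟨w, hw⟩ := hR z
      filter_upwards [eventually_gt_atTop w] with s hs using ⟨w, hs, hw⟩
    -- If every `z` is refuted, then from some stage on the first `c + 1` candidates all are, where
    -- `c` is the supposed final value; the count then exceeds `c`.
    have hall := (Set.finite_lt_nat (refutedCount R s₀ + 1)).eventually_all
      (l := atTop) |>.2 fun z _ => hz z
    obtain ⟨s, h₁, h₂, h₃⟩ := (hall.and ((eventually_ge_atTop (refutedCount R s₀ + 1)).and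
      (eventually_ge_atTop s₀))).exists
    have := le_refutedCount_iff.2 ⟨h₂, fun z hz => h₁ z hz⟩
    rw [hconst s h₃] at this
    omega

open Classical in
/-- The number of initial `y < s` whose `refutedCount` does not change at stage `s`. -/
noncomputable def stableCount (R : ℕ → ℕ → ℕ → Prop) (s : ℕ) : ℕ :=
  Nat.count (fun y => ∀ y' < y + 1, refutedCount (R y') (s + 1) = refutedCount (R y') s) s

/-- The inner `∃∀` statement for `y` means that its `refutedCount` is eventually stationary, and
finitely many `y` are stationary simultaneously from some stage on. The function itself may go up
and down; only its limit matters. -/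
theorem forall_exists_forall_iff_tendsto_stableCount {R : ℕ → ℕ → ℕ → Prop} :
    (∀ y, ∃ z, ∀ w, R y z w) ↔ Tendsto (stableCount R) atTop atTop := by
  classical
  have hle {n s : ℕ} : n ≤ stableCount R s ↔ n ≤ s ∧ ∀ y < n,
      refutedCount (R y) (s + 1) = refutedCount (R y) s := le_count_forall_iff _
  rw [tendsto_atTop]
  simp only [exists_forall_iff_eventually_refutedCount, hle]
  constructor
  · intro h n
    exact (eventually_ge_atTop n).and
      ((Set.finite_lt_nat n).eventually_all.2 fun y _ => h y)
  · intro h y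
    filter_upwards [h (y + 1)] with s hs using hs.2 y y.lt_succ_self

theorem computable_stableCount {R : ℕ → ℕ → ℕ → ℕ → Prop}
    (hR : ComputablePred fun t : ℕ × ℕ × ℕ × ℕ => R t.1 t.2.1 t.2.2.1 t.2.2.2) :
    Computable₂ fun x s => stableCount (R x) s := by
  classical
  have hc : Computable fun t : (ℕ × ℕ) × ℕ => refutedCount (R t.1.1 t.1.2) t.2 := by
    refine (Computable.nat_count (p := fun t : (ℕ × ℕ) × ℕ => fun z => ∀ z' < z + 1, ∃ w < t.2,
      ¬ R t.1.1 t.1.2 z' w) ?_ .snd).of_eq fun t => by unfold refutedCount; congr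
    refine .forall_lt (p := fun (a : ((ℕ × ℕ) × ℕ) × ℕ) z' => ∃ w < a.1.2,
      ¬ R a.1.1.1 a.1.1.2 z' w) ?_ (Computable.succ.comp .snd)
    refine .exists_lt (p := fun (b : (((ℕ × ℕ) × ℕ) × ℕ) × ℕ) w =>
      ¬ R b.1.1.1.1 b.1.1.1.2 b.2 w) (ComputablePred.not ?_)
      (Computable.snd.comp (.comp .fst .fst))
    have h₁ : Computable fun t : ((((ℕ × ℕ) × ℕ) × ℕ) × ℕ) × ℕ => t.1.1.1.1 :=
      .comp .fst (.comp .fst (.comp .fst .fst))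
    exact hR.comp ((Computable.fst.comp h₁).pair ((Computable.snd.comp h₁).pair
      ((Computable.snd.comp .fst).pair .snd)))
  refine (Computable.nat_count (p := fun (t : ℕ × ℕ) y => ∀ y' < y + 1,
    refutedCount (R t.1 y') (t.2 + 1) = refutedCount (R t.1 y') t.2) ?_ .snd).of_eq fun t => by
    unfold stableCount; congr
  refine .forall_lt (p := fun (a : (ℕ × ℕ) × ℕ) y' =>
    refutedCount (R a.1.1 y') (a.1.2 + 1) = refutedCount (R a.1.1 y') a.1.2) ?_
    (Computable.succ.comp .snd)
  have hx : Computable fun t : ((ℕ × ℕ) × ℕ) × ℕ => (t.1.1.1, t.2) :=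
    (Computable.fst.comp (.comp .fst .fst)).pair .snd
  have hs : Computable fun t : ((ℕ × ℕ) × ℕ) × ℕ => t.1.1.2 :=
    Computable.snd.comp (.comp .fst .fst)
  have h₁ := hc.comp (hx.pair (Computable.succ.comp hs))
  have h₂ := hc.comp (hx.pair hs)
  exact .nat_eq h₁ h₂

end Retardation

/-! ### Boxes in a commutative computable group -/

section Box

/-- Lets one number `t < b ^ y` run through all exponent vectors of length `y` with entries below
`b`. -/
theorem exists_digits {b : ℕ} (y : ℕ) {d : ℕ → ℕ} (hd : ∀ i, d i < b) :
    ∃ t < b ^ y, ∀ i < y, t / b ^ i % b = d i := by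
  induction y generalizing d with
  | zero => exact ⟨0, by simp, by simp⟩
  | succ y ih =>
    obtain ⟨t, ht, h⟩ := ih (d := fun i => d (i + 1)) fun i => hd _
    have hb : 0 < b := (Nat.zero_le _).trans_lt (hd 0)
    refine ⟨d 0 + b * t, ?_, fun i hi => ?_⟩
    · calc d 0 + b * t < b * (t + 1) := by have := hd 0; rw [mul_add]; omega
        _ ≤ b * b ^ y := Nat.mul_le_mul_left _ ht
        _ = b ^ (y + 1) := (pow_succ' _ _).symm
    · cases i with
      | zero => simp [Nat.mod_eq_of_lt (hd 0)]
      | succ i =>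
        rw [pow_succ', ← Nat.div_div_eq_div_mul, Nat.add_mul_div_left _ _ hb,
          Nat.div_eq_of_lt (hd 0), zero_add, h i (by omega)]

variable {G : Type*} [CommGroup G] {ν : ℕ → G}

open Classical in
theorem IsComputableGroup.exists_box (hν : IsComputableGroup ν) :
    ∃ v : ℕ → ℕ → ℕ, Computable₂ v ∧ ∀ y s x, x ∈ (finsetOfNumber (v y s)).image ν ↔
      ∃ d : ℕ → ℕ, (∀ i, d i ≤ s) ∧ ∏ i ∈ Finset.range y, ν i ^ d i = x := by
  obtain ⟨m, hm, hm'⟩ := hν.exists_mul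
  obtain ⟨p, hp, hp'⟩ := hν.exists_pow
  obtain ⟨e, he⟩ := hν.1 1
  let elt (a : ℕ × ℕ) (t : ℕ) : ℕ :=
    Nat.rec e (fun i c => m c (p i (t / (a.2 + 1) ^ i % (a.2 + 1)))) a.1
  have helt (a : ℕ × ℕ) (t : ℕ) : ν (elt a t) =
      ∏ i ∈ Finset.range a.1, ν i ^ (t / (a.2 + 1) ^ i % (a.2 + 1)) := by
    obtain ⟨y, s⟩ := a
    induction y with
    | zero => simpa [elt] using he
    | succ y ih =>
      rw [Finset.prod_range_succ, ← ih]
      simp only [elt, hm', hp']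
  have hb : Computable fun x : ((ℕ × ℕ) × ℕ) × ℕ × ℕ => x.1.1.2 + 1 :=
    Computable.succ.comp (.comp .snd (.comp .fst .fst))
  have hi : Computable fun x : ((ℕ × ℕ) × ℕ) × ℕ × ℕ => x.2.1 := .comp .fst .snd
  have hdigit : Computable fun x : ((ℕ × ℕ) × ℕ) × ℕ × ℕ =>
      x.1.2 / (x.1.1.2 + 1) ^ x.2.1 % (x.1.1.2 + 1) :=
    Primrec.nat_mod.to_comp.comp (Primrec.nat_div.to_comp.comp (.comp .snd .fst)
      (.nat_pow hb hi)) hb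
  have hstep : Computable₂ fun (x : (ℕ × ℕ) × ℕ) (c : ℕ × ℕ) =>
      m c.2 (p c.1 (x.2 / (x.1.2 + 1) ^ c.1 % (x.1.2 + 1))) :=
    hm.comp (.comp .snd .snd) (hp.comp hi hdigit)
  have hy : Computable fun a : (ℕ × ℕ) × ℕ => a.1.1 := .comp .fst .fst
  have heltc : Computable₂ elt := (Computable.nat_rec hy (.const e) hstep).of_eq fun _ => rfl
  refine ⟨fun y s => imageNumber (elt (y, s)) ((s + 1) ^ y),
    Computable.imageNumber heltc (.nat_pow (Computable.succ.comp .snd) .fst), fun y s x => ?_⟩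
  simp only [finsetOfNumber_imageNumber, Finset.image_image, Finset.mem_image, Finset.mem_range,
    Function.comp_apply, helt]
  constructor
  · rintro ⟨t, -, rfl⟩
    exact ⟨_, fun i => Nat.le_of_lt_succ (Nat.mod_lt _ s.succ_pos), rfl⟩
  · rintro ⟨d, hd, rfl⟩
    obtain ⟨t, ht, h⟩ := exists_digits y fun i => Nat.lt_succ_of_le (hd i)
    exact ⟨t, ht, Finset.prod_congr rfl fun i hi => by rw [h i (Finset.mem_range.1 hi)]⟩

open Filter in
/-- Boxes spanned by the first `h s` elements form a Foelner sequence iff `h` tends to infinity,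
provided that the group is not finitely generated. -/
theorem isFoelnerSeq_box_iff (hν : Function.Surjective ν)
    (hG : ∀ y, Subgroup.closure (ν '' Set.Iio y) ≠ ⊤) {F : ℕ → Finset G} {h : ℕ → ℕ}
    (hF : ∀ s x, x ∈ F s ↔
      ∃ d : ℕ → ℕ, (∀ i, d i ≤ s) ∧ ∏ i ∈ Finset.range (h s), ν i ^ d i = x) :
    IsFoelnerSeq F ↔ Tendsto h atTop atTop := by
  classical
  have hne (s : ℕ) : (F s).Nonempty := ⟨1, (hF s 1).2 ⟨fun _ => 0, by simp, by simp⟩⟩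
  rw [isFoelnerSeq_iff]
  constructor
  · rintro ⟨-, hfol⟩
    refine tendsto_atTop.2 fun y => ?_
    obtain ⟨g, hg⟩ : ∃ g, g ∉ Subgroup.closure (ν '' Set.Iio y) :=
      not_forall.1 ((Subgroup.eq_top_iff' _).not.1 (hG y))
    -- With `gF` disjoint from `F`, the factor `2` gives `2|F| ≤ |F|`, impossible for non-empty `F`.
    obtain ⟨N, hN⟩ := hfol g 2
    filter_upwards [eventually_ge_atTop N] with s hs
    by_contra! hy
    have hmem {x : G} (hx : x ∈ F s) : x ∈ Subgroup.closure (ν '' Set.Iio y) := by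
      obtain ⟨d, -, rfl⟩ := (hF s x).1 hx
      exact Subgroup.prod_mem _ fun i hi => Subgroup.pow_mem _ (Subgroup.subset_closure
        (Set.mem_image_of_mem ν (Set.mem_Iio.2 ((Finset.mem_range.1 hi).trans hy)))) _
    have hdisj : F s \ (F s).image (fun x => g * x) = F s := by
      refine Finset.sdiff_eq_self_of_disjoint (Finset.disjoint_left.2 fun x hx hx' => hg ?_)
      obtain ⟨z, hz, rfl⟩ := Finset.mem_image.1 hx'
      exact (Subgroup.mul_mem_cancel_right _ (hmem hz)).1 (hmem hx)
    have h₁ := hN s hs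
    rw [hdisj] at h₁
    have := (hne s).card_pos
    omega
  · intro hh
    refine ⟨hne, fun g k => ?_⟩
    obtain ⟨i, rfl⟩ := hν g
    obtain ⟨N, hN⟩ := eventually_atTop.1 (tendsto_atTop.1 hh (i + 1))
    refine ⟨max N k, fun s hs => ?_⟩
    have hi : i ∈ Finset.range (h s) := Finset.mem_range.2 (hN s (le_of_max_le_left hs))
    refine card_sdiff_image_mul_le fun x hx hx' l hl => ?_
    obtain ⟨d, hd, rfl⟩ := (hF s x).1 hx
    have hupd (c : ℕ) : ∏ j ∈ Finset.range (h s), ν j ^ Function.update d i c j =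
        ν i ^ c * ∏ j ∈ (Finset.range (h s)).erase i, ν j ^ d j := by
      rw [← Finset.mul_prod_erase _ _ hi, Function.update_self]
      congr 1
      refine Finset.prod_congr rfl fun j hj => ?_
      rw [Function.update_of_ne (Finset.ne_of_mem_erase hj)]
    have hupd_mem {c : ℕ} (hc : c ≤ s) :
        ν i ^ c * ∏ j ∈ (Finset.range (h s)).erase i, ν j ^ d j ∈ F s := by
      refine (hF s _).2 ⟨Function.update d i c, fun j => ?_, hupd c⟩
      rcases eq_or_ne j i with rfl | hj
      · simpa using hc
      · simpa [hj] using hd j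
    rw [← Finset.mul_prod_erase _ _ hi] at hx' ⊢
    -- A positive exponent of `ν i` could be lowered by one, putting the point into `ν i * F s`. So
    -- a point outside has exponent `0`, leaving room for `l < k ≤ s` further factors.
    have hdi : d i = 0 := by
      by_contra h0
      obtain ⟨c, hc⟩ := Nat.exists_eq_succ_of_ne_zero h0
      refine hx' (Finset.mem_image.2 ⟨_, hupd_mem (c := c) ?_, ?_⟩)
      · have := hd i; omega
      · rw [hc, pow_succ', mul_assoc]
    rw [hdi, pow_zero, one_mul]
    exact hupd_mem (hl.le.trans (le_of_max_le_right hs))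

end Box

/-! ### The reduction, and the case of a direct sum of copies of `ℤ` -/

section Completeness

/-- The s-m-n theorem, by currying a program for the two-variable function. -/
theorem exists_computable_phi_eq {f : ℕ → ℕ → ℕ} (hf : Computable₂ f) :
    ∃ g : ℕ → ℕ, Computable g ∧ ∀ x s, phi (g x) s = Part.some (f x s) := by
  have hf' : Computable fun n : ℕ => f n.unpair.1 n.unpair.2 :=
    hf.comp (.comp .fst .unpair) (.comp .snd .unpair)
  obtain ⟨c, hc⟩ := Nat.Partrec.Code.exists_code.1 (Partrec.nat_iff.1 hf'.partrec)
  refine ⟨fun x => Encodable.encode (c.curry x), ?_, fun x s => ?_⟩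
  · exact Computable.encode.comp
      (Nat.Partrec.Code.primrec₂_curry.to_comp.comp (.const c) .id)
  · rw [phi, Denumerable.ofNat_encode, Nat.Partrec.Code.eval_curry, hc]
    simp

theorem isPi0Complete_three_foelnerIndices {G : Type*} [CommGroup G] {ν : ℕ → G}
    (hν : IsComputableGroup ν) (hG : ∀ y, Subgroup.closure (ν '' Set.Iio y) ≠ ⊤) :
    IsPi0Complete 3 (foelnerIndices ν) := by
  classical
  refine ⟨hν.isPi0_three_foelnerIndices, fun B hB => ?_⟩
  obtain ⟨R, hR, hBR⟩ := isPi0_three_iff.1 hB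
  obtain ⟨v, hv, hbox⟩ := hν.exists_box
  obtain ⟨g, hg, hphi⟩ := exists_computable_phi_eq (f := fun x s => v (stableCount (R x) s) s)
    (hv.comp (computable_stableCount hR) .snd)
  refine ⟨g, hg, fun x => ?_⟩
  have hiff := isFoelnerSeq_box_iff hν.1 hG
    (F := fun s => (finsetOfNumber (v (stableCount (R x) s) s)).image ν) fun s => hbox _ s
  change x ∈ B ↔ g x ∈ foelnerIndices ν
  rw [hBR, forall_exists_forall_iff_tendsto_stableCount, ← hiff]
  constructor
  · intro hF
    exact ⟨_, fun s => by rw [hphi]; exact Part.mem_some _, hF⟩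
  · rintro ⟨f, hf, hF⟩
    convert hF using 3 with s
    have := hf s
    rw [hphi, Part.mem_some_iff] at this
    rw [this]

/-- Finitely many elements have supports in a finite set; evaluation at a coordinate `N` outside it
kills the subgroup they generate but not the `N`-th basis vector. -/
theorem closure_image_Iio_ne_top {G : Type*} [Group G]
    (e : G ≃* Multiplicative (DirectSum ℕ fun _ => ℤ)) (ν : ℕ → G) (y : ℕ) :
    Subgroup.closure (ν '' Set.Iio y) ≠ ⊤ := by
  classical
  let c (i : ℕ) : Finset ℕ := DFinsupp.support (Multiplicative.toAdd (e (ν i)))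
  obtain ⟨N, hN⟩ := Infinite.exists_notMem_finset ((Finset.range y).biUnion c)
  let f : G →* Multiplicative ℤ :=
    (AddMonoidHom.toMultiplicative (DFinsupp.evalAddMonoidHom N)).comp e.toMonoidHom
  have hle : Subgroup.closure (ν '' Set.Iio y) ≤ f.ker := by
    rw [Subgroup.closure_le]
    rintro _ ⟨i, hi, rfl⟩
    simp only [Finset.mem_biUnion, Finset.mem_range, not_exists, not_and] at hN
    exact DFinsupp.notMem_support_iff.1 (hN i hi)
  intro htop
  have : e.symm (Multiplicative.ofAdd (DirectSum.of (fun _ => ℤ) N 1)) ∈ f.ker :=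
    hle (htop ▸ Subgroup.mem_top _)
  rw [MonoidHom.mem_ker] at this
  have h' : (Multiplicative.toAdd (e (e.symm (Multiplicative.ofAdd
    (DirectSum.of (fun _ => ℤ) N 1))))) N = 0 := this
  rw [e.apply_symm_apply, toAdd_ofAdd, DirectSum.of_eq_same] at h'
  exact one_ne_zero h'

end Completeness

theorem mainTheorem6 {G : Type*} [Group G] (ν : ℕ → G) (hν : IsComputableGroup ν) :
    IsPi0 3 (foelnerIndices ν) ∧
      (Nonempty (G ≃* Multiplicative (DirectSum ℕ fun _ => ℤ)) →
        IsPi0Complete 3 (foelnerIndices ν) ∧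
          (fun e => e ∈ allFiniteIndices) ≤₀ (fun m => m ∈ foelnerIndices ν)) := by
  refine ⟨hν.isPi0_three_foelnerIndices, fun ⟨e⟩ => ?_⟩
  have hcomplete : IsPi0Complete 3 (foelnerIndices ν) := by
    -- Extending the given `Group` instance keeps the multiplication to which `hν` refers.
    let : CommGroup G :=
      { ‹Group G› with mul_comm := fun a b => e.injective (by rw [map_mul, map_mul, mul_comm]) }
    exact isPi0Complete_three_foelnerIndices hν (closure_image_Iio_ne_top e ν)
  exact ⟨hcomplete, hcomplete.2 _ isPi0_three_allFiniteIndices⟩
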